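/- Let $\mathfrak c = 2^{\aleph_0}$ and let the dominating number $\mathfrak d$ be the least cardinality of a family $D\subseteq\omega^\omega$ such that for every $f\in\omega^\omega$ there is $g\in D$ with $f(n)\le g(n)$ for all but finitely many $n$. An almost disjoint family (on $\omega$) is an infinite set $\mathcal A$ of infinite subsets of $\omega$ such that $A\cap B$ is finite for any two distinct $A,B\in\mathcal A$; a mad family is an almost disjoint family that is maximal with respect to inclusion among almost disjoint families. The ideal generated by $\mathcal A$ is $$\mathcal I(\mathcal A)=\Big\{I\subseteq\omega : \text{there is a finite } \mathcal B\subseteq\mathcal A \text{ such that } I\setminus\bigcup\mathcal B \text{ is finite}\Big\}.$$ The power set $\mathcal P(\omega)$ carries the topology of the Cantor space $2^\omega$, subsets of $\omega$ being identified with their characteristic functions, and families of subsets of $\omega$ carry the subspace topology. A topological space $X$ is Menger if for every sequence $\langle \mathcal U_n : n\in\omega\rangle$ of open covers of $X$ there are finite $\mathcal V_n\subseteq\mathcal U_n$ such that $\{\bigcup\mathcal V_n : n\in\omega\}$ covers $X$. **Proposition 3.2.** If $\mathfrak d=\mathfrak c$, then there is an infinite mad family $\mathcal A$ on $\omega$ such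 that $\mathcal I(\mathcal A)$, as a subspace of $\mathcal P(\omega)$, is Menger. -/

import Mathlib

/-- A topological space is Menger if for every sequence of open covers `U n` one can choose finite
subfamilies `V n ⊆ U n` whose unions `⋃₀ V n` together cover the space. -/
def MengerSpace (X : Type*) [TopologicalSpace X] : Prop :=
  ∀ U : ℕ → Set (Set X),
    (∀ n, (∀ u ∈ U n, IsOpen u) ∧ ⋃₀ U n = Set.univ) →
    ∃ V : ℕ → Set (Set X),
      (∀ n, V n ⊆ U n ∧ (V n).Finite) ∧ ⋃ n, ⋃₀ V n = Set.univ

/-- A family `S` of subsets of `ℕ`, viewed as a subset of the Cantor space `ℕ → Bool`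
(with the product topology) by identifying sets with their characteristic functions. -/
def charFunctionSet (S : Set (Set ℕ)) : Set (ℕ → Bool) :=
  {x | {n | x n = true} ∈ S}

/-- `S` is Menger as a subspace of the power set of `ℕ`. -/
def IsMengerFamily (S : Set (Set ℕ)) : Prop :=
  MengerSpace (charFunctionSet S)

/-- An almost disjoint family on `ℕ`: an infinite family of infinite subsets of `ℕ`, any two
distinct members of which have finite intersection. -/
def IsAlmostDisjointFamily (A : Set (Set ℕ)) : Prop :=
  A.Infinite ∧ (∀ a ∈ A, a.Infinite) ∧ A.Pairwise fun a b => (a ∩ b).Finite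

/-- A mad family on `ℕ`: an almost disjoint family that is maximal under inclusion. -/
def IsMadFamily (A : Set (Set ℕ)) : Prop :=
  Maximal IsAlmostDisjointFamily A

/-- The ideal generated by `A`: the subsets of `ℕ` that are covered, up to finitely many points, by
the union of finitely many members of `A`. -/
def generatedIdeal (A : Set (Set ℕ)) : Set (Set ℕ) :=
  {I | ∃ B ⊆ A, B.Finite ∧ (I \ ⋃₀ B).Finite}

/-- A family of functions `ℕ → ℕ` is dominating if every function is bounded by some member of
the family at all but finitely many arguments. -/
def IsDominating (D : Set (ℕ → ℕ)) : Prop :=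
  ∀ f : ℕ → ℕ, ∃ g ∈ D, ∀ᶠ n in Filter.atTop, f n ≤ g n

/-- The dominating number: the least cardinality of a dominating family. -/
noncomputable def dominatingNumber : Cardinal.{0} :=
  sInf {κ | ∃ D : Set (ℕ → ℕ), IsDominating D ∧ Cardinal.mk D = κ}

/-! An ideal `I` is Menger as soon as every sequence `X n` of families of finite sets, each avoiding
`I` in the sense of `AvoidsFamily`, has a bound `g` for which `boundedUnion X g` still avoids `I`:
by compactness, a finite piece of an open cover covers all members of `I` missing some finite set
(`isMengerFamily_of_avoidsFamily`). A mad family with this property is built by recursion of length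
𝔠, running through all pairs (sequence `X`, set `b`). Each stage involves fewer than 𝔡 = 𝔠
generators, so a suitable `g` exists for the current ideal (`exists_avoidsFamily_boundedUnion`). If
`b` is infinite and almost disjoint from the family so far, an infinite subset of it is added,
sparse enough to preserve all avoidance promises made until then
(`exists_subset_avoidsFamily_insert`). The new sets give maximality, the kept promises the Menger
property. -/

open Cardinal

/-- `Z` has, for every member of `I`, an element disjoint from it. -/
def AvoidsFamily (Z : Set (Finset ℕ)) (I : Set (Set ℕ)) : Prop :=
  ∀ J ∈ I, ∃ s ∈ Z, Disjoint (s : Set ℕ) J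

/-- The elements of the `n`-th member of `X` that lie below `g n`, for all `n`. -/
def boundedUnion (X : ℕ → Set (Finset ℕ)) (g : ℕ → ℕ) : Set (Finset ℕ) :=
  {s | ∃ n, s ∈ X n ∧ s ⊆ Finset.range (g n)}

/-! ### The generated ideal and a small cofinal set in it -/

theorem AvoidsFamily.mono {Z : Set (Finset ℕ)} {I I' : Set (Set ℕ)} (h : AvoidsFamily Z I)
    (hI : I' ⊆ I) : AvoidsFamily Z I' :=
  fun J hJ => h J (hI hJ)

theorem generatedIdeal_mono {A A' : Set (Set ℕ)} (h : A ⊆ A') :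
    generatedIdeal A ⊆ generatedIdeal A' := by
  rintro J ⟨B, hB, hf, hJ⟩
  exact ⟨B, hB.trans h, hf, hJ⟩

theorem generatedIdeal_subset {A : Set (Set ℕ)} {J J' : Set ℕ} (h : J ∈ generatedIdeal A)
    (hJ : J' ⊆ J) : J' ∈ generatedIdeal A := by
  obtain ⟨B, hB, hf, hJB⟩ := h
  exact ⟨B, hB, hf, hJB.subset (Set.sdiff_subset_sdiff_left hJ)⟩

theorem generatedIdeal_union_Iio {A : Set (Set ℕ)} {J : Set ℕ} (h : J ∈ generatedIdeal A)
    (m : ℕ) : J ∪ Set.Iio m ∈ generatedIdeal A := by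
  obtain ⟨B, hB, hf, hJ⟩ := h
  refine ⟨B, hB, hf, ?_⟩
  rw [Set.union_sdiff_distrib]
  exact hJ.union ((Set.finite_Iio m).subset Set.sdiff_subset)

theorem generatedIdeal_insert {A : Set (Set ℕ)} {a J : Set ℕ}
    (h : J ∈ generatedIdeal (insert a A)) : ∃ J' ∈ generatedIdeal A, J ⊆ J' ∪ a := by
  obtain ⟨B, hB, hf, hJ⟩ := h
  refine ⟨J \ a, ⟨B \ {a}, ?_, hf.subset Set.sdiff_subset, hJ.subset ?_⟩, ?_⟩
  · rintro b ⟨hb, hba⟩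
    exact (hB hb).resolve_left hba
  · rintro x ⟨⟨hx, hxa⟩, hxB⟩
    refine ⟨hx, ?_⟩
    rintro ⟨b, hb, hxb⟩
    refine hxB ⟨b, ⟨hb, ?_⟩, hxb⟩
    rintro rfl
    exact hxa hxb
  · intro x hx
    by_cases hxa : x ∈ a
    · exact Or.inr hxa
    · exact Or.inl ⟨hx, hxa⟩

/-- The generators of the ideal generated by `A`, indexed by a type of size `max #A ℵ₀`. -/
def idealGenerator (A : Set (Set ℕ)) (k : Finset A × ℕ) : Set ℕ :=
  (⋃ a ∈ k.1, (a : Set ℕ)) ∪ Set.Iio k.2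

theorem idealGenerator_mem (A : Set (Set ℕ)) (k : Finset A × ℕ) :
    idealGenerator A k ∈ generatedIdeal A := by
  refine generatedIdeal_union_Iio ⟨Subtype.val '' (k.1 : Set A), ?_, ?_, ?_⟩ _
  · rintro _ ⟨a, -, rfl⟩
    exact a.2
  · exact k.1.finite_toSet.image _
  · convert Set.finite_empty
    rw [Set.sdiff_eq_empty]
    intro x hx
    simp only [Set.mem_iUnion] at hx
    obtain ⟨a, ha, hx⟩ := hx
    exact ⟨a, ⟨a, ha, rfl⟩, hx⟩

theorem exists_subset_idealGenerator {A : Set (Set ℕ)} {J : Set ℕ} (h : J ∈ generatedIdeal A) :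
    ∃ k, J ⊆ idealGenerator A k := by
  classical
  obtain ⟨B, hB, hf, hJ⟩ := h
  obtain ⟨m, hm⟩ := hJ.bddAbove
  refine ⟨⟨hf.toFinset.subtype (· ∈ A), m + 1⟩, fun x hx => ?_⟩
  by_cases hxB : x ∈ ⋃₀ B
  · obtain ⟨b, hb, hxb⟩ := hxB
    refine Or.inl ?_
    simp only [Set.mem_iUnion]
    exact ⟨⟨b, hB hb⟩, by simpa using hb, hxb⟩
  · exact Or.inr (Nat.lt_succ_of_le (hm ⟨hx, hxB⟩))

theorem mk_idealGenerator_index_lt {A : Set (Set ℕ)} {κ : Cardinal.{0}} (hA : #A < κ)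
    (hκ : ℵ₀ < κ) : #(Finset A × ℕ) < κ := by
  rw [mk_prod, lift_id, lift_id]
  refine mul_lt_of_lt hκ.le ?_ (by simpa using hκ)
  rcases finite_or_infinite A with h | h
  · exact (lt_aleph0_of_finite _).trans hκ
  · rwa [mk_finset_of_infinite]

/-! ### Diagonalizing against fewer than 𝔡 functions -/

theorem exists_not_dominated {K : Type} (hK : #K < dominatingNumber) (h : K → ℕ → ℕ) :
    ∃ g : ℕ → ℕ, ∀ k, ∃ᶠ n in Filter.atTop, h k n < g n := by
  by_contra! hcon
  refine (csInf_le' ?_ : dominatingNumber ≤ #(Set.range h)).not_gt (mk_range_le.trans_lt hK)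
  refine ⟨Set.range h, fun f => ?_, rfl⟩
  obtain ⟨k, hk⟩ := hcon f
  exact ⟨h k, ⟨k, rfl⟩, by simpa using hk⟩

/-- Each generator `k` yields the function sending `n` to the maximum of a witness in `X n`. A `g`
that no such function dominates exceeds that maximum at some `n`, and one `n` is enough. -/
theorem exists_avoidsFamily_boundedUnion {A : Set (Set ℕ)} (hA : #A < dominatingNumber)
    (hd : ℵ₀ < dominatingNumber) {X : ℕ → Set (Finset ℕ)}
    (hX : ∀ n, AvoidsFamily (X n) (generatedIdeal A)) :
    ∃ g, AvoidsFamily (boundedUnion X g) (generatedIdeal A) := by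
  choose s hs hdis using fun (k : Finset A × ℕ) n => hX n _ (idealGenerator_mem A k)
  obtain ⟨g, hg⟩ := exists_not_dominated (mk_idealGenerator_index_lt hA hd)
    fun k n => (s k n).sup id
  refine ⟨g, fun J hJ => ?_⟩
  obtain ⟨k, hk⟩ := exists_subset_idealGenerator hJ
  obtain ⟨n, hn⟩ := (hg k).exists
  refine ⟨s k n, ⟨n, hs k n, fun x hx => ?_⟩, (hdis k n).mono_right hk⟩
  exact Finset.mem_range.2 ((Finset.le_sup (f := id) hx).trans_lt hn)

/-- Fewer than `𝔡` functions cannot all bound the gaps of every infinite subset of `b`. -/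
theorem exists_subset_large_gaps {K : Type} (hK : #K < dominatingNumber) (h : K → ℕ → ℕ)
    {b : Set ℕ} (hb : b.Infinite) :
    ∃ a ⊆ b, a.Infinite ∧ ∀ k, ∃ m, ∀ x ∈ a, x < m ∨ h k m < x := by
  let H : K → ℕ → ℕ := fun k n => (Finset.range (n + 1)).sup (h k)
  have hH : ∀ k, Monotone (H k) := fun k m n hmn =>
    Finset.sup_mono (Finset.range_mono (by omega))
  have hhH : ∀ k n, h k n ≤ H k n := fun k n => Finset.le_sup (f := h k) (by simp)
  -- `H k` is iterated twice because `n` need not be a point of the sequence: one step reaches the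
  -- next point, the second the point after it.
  obtain ⟨g, hg⟩ := exists_not_dominated hK fun k n => H k (H k (n + 1) + 1)
  choose next hnb hnext using fun n => hb.exists_gt n
  let G : ℕ → ℕ := fun n => (Finset.range (n + 1)).sup g
  have hG : Monotone G := fun m n hmn => Finset.sup_mono (Finset.range_mono (by omega))
  have hgG : ∀ n, g n ≤ G n := fun n => Finset.le_sup (f := g) (by simp)
  let e : ℕ → ℕ := fun i => Nat.rec (next 0) (fun _ y => next (max y (G y))) i
  have he : ∀ i, e (i + 1) = next (max (e i) (G (e i))) := fun i => rfl
  have hlt : ∀ i, e i < e (i + 1) := fun i => by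
    rw [he]; exact (le_max_left _ _).trans_lt (hnext _)
  have hGlt : ∀ i, G (e i) < e (i + 1) := fun i => by
    rw [he]; exact (le_max_right _ _).trans_lt (hnext _)
  have hmono : StrictMono e := strictMono_nat_of_lt_succ hlt
  refine ⟨Set.range e, ?_, Set.infinite_range_of_injective hmono.injective, fun k => ?_⟩
  · rintro _ ⟨_ | i, rfl⟩
    · exact hnb _
    · exact hnb _
  -- One long gap suffices, with `m` just after its left endpoint.
  suffices ∃ i, H k (e i + 1) < e (i + 1) by
    obtain ⟨i, hi⟩ := this
    refine ⟨e i + 1, ?_⟩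
    rintro _ ⟨j, rfl⟩
    rcases le_or_gt j i with hj | hj
    · exact Or.inl (Nat.lt_succ_of_le (hmono.monotone hj))
    · exact Or.inr ((hhH _ _).trans_lt (hi.trans_le (hmono.monotone hj)))
  by_contra! hcon
  obtain ⟨n, hn, hgn⟩ := (Filter.frequently_atTop.1 (hg k)) (e 0)
  have hex : ∃ i, n < e i := ⟨n + 1, hmono.le_apply.trans_lt' (Nat.lt_succ_self n)⟩
  obtain ⟨i, hi, hmin⟩ : ∃ i, n < e (i + 1) ∧ e i ≤ n := by
    classical
    obtain ⟨i, hi⟩ : ∃ i, Nat.find hex = i + 1 := Nat.exists_eq_succ_of_ne_zero (by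
      intro h0
      have := Nat.find_spec hex
      rw [h0] at this
      omega)
    refine ⟨i, hi ▸ Nat.find_spec hex, not_lt.1 (Nat.find_min hex (by omega))⟩
  have h1 : g n ≤ e (i + 2) := (hgG n).trans ((hG hi.le).trans (hGlt (i + 1)).le)
  have h2 : e (i + 2) ≤ H k (e (i + 1) + 1) := hcon (i + 1)
  have h3 : e (i + 1) ≤ H k (n + 1) := (hcon i).trans (hH k (by omega))
  have h4 := hH k (show e (i + 1) + 1 ≤ H k (n + 1) + 1 by omega)
  omega

/-- Witnesses are chosen disjoint from a generator and from `[0, m)`, so the new set can meet them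
only between `m` and their maximum. A gap of the new set there saves the witness. -/
theorem exists_subset_avoidsFamily_insert {A : Set (Set ℕ)} (hA : #A < dominatingNumber)
    (hd : ℵ₀ < dominatingNumber) {L : Type} (hL : #L < dominatingNumber)
    {Z : L → Set (Finset ℕ)} (hZ : ∀ l, AvoidsFamily (Z l) (generatedIdeal A))
    {b : Set ℕ} (hb : b.Infinite) :
    ∃ a ⊆ b, a.Infinite ∧ ∀ l, AvoidsFamily (Z l) (generatedIdeal (insert a A)) := by
  choose s hs hdis using fun (p : L × (Finset A × ℕ)) m =>
    hZ p.1 _ (generatedIdeal_union_Iio (idealGenerator_mem A p.2) m)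
  have hK : #(L × (Finset A × ℕ)) < dominatingNumber := by
    rw [mk_prod, lift_id, lift_id]
    exact mul_lt_of_lt hd.le hL (mk_idealGenerator_index_lt hA hd)
  obtain ⟨a, hab, ha, hgap⟩ := exists_subset_large_gaps hK (fun p m => (s p m).sup id) hb
  refine ⟨a, hab, ha, fun l J hJ => ?_⟩
  obtain ⟨J', hJ', hJJ'⟩ := generatedIdeal_insert hJ
  obtain ⟨k, hk⟩ := exists_subset_idealGenerator hJ'
  obtain ⟨m, hm⟩ := hgap (l, k)
  refine ⟨s (l, k) m, hs (l, k) m, Set.disjoint_left.2 fun x hx hxJ => ?_⟩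
  have hx' := Set.disjoint_left.1 (hdis (l, k) m) hx
  rcases hJJ' hxJ with h | h
  · exact hx' (Or.inl (hk h))
  · rcases hm x h with h' | h'
    · exact hx' (Or.inr h')
    · exact h'.not_ge (Finset.le_sup (f := id) hx)

/-! ### A combinatorial criterion for the Menger property -/

theorem isClosed_setOf_forall_eq_false (s : Set ℕ) :
    IsClosed {x : ℕ → Bool | ∀ i ∈ s, x i = false} := by
  simp only [Set.ofPred_forall]
  exact isClosed_iInter fun i => isClosed_iInter fun _ =>
    isClosed_eq (continuous_apply i) continuous_const

/-- A downward closed family is covered by finitely many open sets near the power set of each of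
its members, so the Menger property can be tested on finite sets. -/
theorem isMengerFamily_of_avoidsFamily {I : Set (Set ℕ)} (hI : ∀ J ∈ I, ∀ J' ⊆ J, J' ∈ I)
    (h : ∀ X : ℕ → Set (Finset ℕ), (∀ n, AvoidsFamily (X n) I) →
      ∃ g, AvoidsFamily (boundedUnion X g) I) : IsMengerFamily I := by
  intro U hU
  let X : ℕ → Set (Finset ℕ) := fun n => {s | ∃ V ⊆ U n, V.Finite ∧
    ∀ x : charFunctionSet I, (∀ i ∈ s, x.1 i = false) → x ∈ ⋃₀ V}
  have hX : ∀ n, AvoidsFamily (X n) I := by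
    intro n J hJ
    have hmem : ∀ x : ℕ → Bool, (∀ i ∈ Jᶜ, x i = false) → x ∈ charFunctionSet I := by
      intro x hx
      refine hI J hJ _ fun i hi => ?_
      by_contra hiJ
      have := hx i hiJ
      simp_all
    choose O hO hOU using fun u : U n => isOpen_induced_iff.1 ((hU n).1 u u.2)
    have hcov : {x : ℕ → Bool | ∀ i ∈ Jᶜ, x i = false} ⊆ ⋃ u, O u := by
      intro x hx
      obtain ⟨u, hu, hxu⟩ : (⟨x, hmem x hx⟩ : charFunctionSet I) ∈ ⋃₀ U n := by
        rw [(hU n).2]; trivial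
      refine Set.mem_iUnion.2 ⟨⟨u, hu⟩, ?_⟩
      have : (⟨x, hmem x hx⟩ : charFunctionSet I) ∈ Subtype.val ⁻¹' O ⟨u, hu⟩ := by
        rw [hOU]; exact hxu
      exact this
    obtain ⟨t, ht⟩ := (isClosed_setOf_forall_eq_false Jᶜ).isCompact.elim_finite_subcover O hO hcov
    -- The power set of `J` is the intersection of these decreasing compact sets, so one of them
    -- already lies in the open set.
    obtain ⟨m, hm⟩ := exists_subset_nhds_of_isCompact'
      (V := fun m : ℕ => {x : ℕ → Bool | ∀ i ∈ Set.Iio m \ J, x i = false})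
      (U := ⋃ u ∈ t, O u)
      (directed_of_isDirected_le fun m m' hmm' x hx i hi =>
        hx i ⟨lt_of_lt_of_le hi.1 hmm', hi.2⟩)
      (fun m => (isClosed_setOf_forall_eq_false _).isCompact)
      (fun m => isClosed_setOf_forall_eq_false _)
      (fun x hx => (isOpen_biUnion fun u _ => hO u).mem_nhds (ht fun i hi =>
        Set.mem_iInter.1 hx (i + 1) i ⟨Nat.lt_succ_self i, hi⟩))
    classical
    refine ⟨(Finset.range m).filter (· ∉ J), ⟨Subtype.val '' (t : Set (U n)), ?_,
      t.finite_toSet.image _, ?_⟩, ?_⟩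
    · rintro _ ⟨u, -, rfl⟩
      exact u.2
    · intro x hx
      have hxm := hm (show x.1 ∈ {x : ℕ → Bool | ∀ i ∈ Set.Iio m \ J, x i = false} from
        fun i hi => hx i (by simpa using hi))
      simp only [Set.mem_iUnion] at hxm
      obtain ⟨u, hu, hxu⟩ := hxm
      refine ⟨u, ⟨u, hu, rfl⟩, ?_⟩
      rw [← hOU u]
      exact hxu
    · refine Set.disjoint_left.2 fun i hi => ?_
      simp at hi
      exact hi.2
  obtain ⟨g, hg⟩ := h X hX
  choose! V hVU hVf hV using fun n s (hs : s ∈ X n) => hs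
  refine ⟨fun n => ⋃ s ∈ {s | s ∈ X n ∧ s ⊆ Finset.range (g n)}, V n s, fun n => ⟨?_, ?_⟩, ?_⟩
  · exact Set.iUnion₂_subset fun s hs => hVU n s hs.1
  -- The bound `g n` leaves only finitely many `s`.
  · refine Set.Finite.biUnion ?_ fun s hs => hVf n s hs.1
    exact (Finset.finite_toSet (Finset.range (g n)).powerset).subset fun s hs =>
      Finset.mem_coe.2 (Finset.mem_powerset.2 hs.2)
  · refine Set.eq_univ_of_forall fun x => ?_
    obtain ⟨s, ⟨n, hs, hsg⟩, hdis⟩ := hg _ x.2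
    obtain ⟨u, hu, hxu⟩ := hV n s hs x fun i hi => by
      have := Set.disjoint_left.1 hdis hi
      simpa using this
    refine Set.mem_iUnion.2 ⟨n, u, ?_, hxu⟩
    simp only [Set.mem_iUnion]
    exact ⟨s, ⟨hs, hsg⟩, hu⟩

/-! ### Transfinite recursion and almost disjoint families -/

/-- Recursion along a well-order in which each value is chosen subject to a condition on the
earlier values. -/
theorem exists_forall_of_wellFoundedLT {ι β : Type*} [LinearOrder ι] [WellFoundedLT ι] [Nonempty β]
    (P : ι → (ι → β) → β → Prop)
    (hP : ∀ t f f' y, (∀ u < t, f u = f' u) → P t f y → P t f' y)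
    (h : ∀ t f, (∀ u < t, P u f (f u)) → ∃ y, P t f y) : ∃ f : ι → β, ∀ t, P t f (f t) := by
  classical
  -- Values from `t` on are filled in arbitrarily; `hP` makes them irrelevant.
  let e : ∀ t, (∀ u, u < t → β) → ι → β := fun t f u =>
    if hu : u < t then f u hu else Classical.arbitrary β
  let F : ∀ t, (∀ u, u < t → β) → β := fun t f => Classical.epsilon (P t (e t f))
  let φ : ι → β := (wellFounded_lt (α := ι)).fix F
  have hφ : ∀ t, φ t = Classical.epsilon (P t (e t fun u _ => φ u)) := fun t =>
    (wellFounded_lt (α := ι)).fix_eq F t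
  have he : ∀ t, ∀ u < t, e t (fun u _ => φ u) u = φ u := fun t u hu => dif_pos hu
  refine ⟨φ, fun t => ?_⟩
  induction t using WellFoundedLT.induction with
  | ind t ih =>
    obtain ⟨y, hy⟩ := h t φ ih
    have := Classical.epsilon_spec ⟨y, hP t φ _ y (fun u hu => (he t u hu).symm) hy⟩
    rw [← hφ t] at this
    exact hP t _ _ _ (he t) this

/-- A member of the ideal uses finitely many generators, hence has a largest index; so promises
survive limits for free. -/
theorem avoidsFamily_generatedIdeal_of_forall_Iic {ι : Type*} [LinearOrder ι]
    {A : Set (Set ℕ)} {a : ι → Set ℕ} {Z : Set (Finset ℕ)} {u : ι} {S : Set ι}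
    (h0 : AvoidsFamily Z (generatedIdeal (A ∪ a '' Set.Iio u)))
    (h : ∀ v ∈ S, u ≤ v → AvoidsFamily Z (generatedIdeal (A ∪ a '' Set.Iic v))) :
    AvoidsFamily Z (generatedIdeal (A ∪ a '' S)) := by
  rintro J ⟨B, hB, hf, hJ⟩
  obtain ⟨T, hTS, hT, hTB⟩ : ∃ T ⊆ S, T.Finite ∧ B ⊆ A ∪ a '' T := by
    obtain ⟨T, hTS, hT, hTB⟩ := Set.exists_subset_image_finite_and.1
      ⟨B \ A, fun b hb => (hB hb.1).resolve_left hb.2, hf.subset Set.sdiff_subset, rfl⟩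
    refine ⟨T, hTS, hT, fun b hb => ?_⟩
    by_cases hbA : b ∈ A
    · exact Or.inl hbA
    · exact Or.inr (hTB ▸ ⟨hb, hbA⟩)
  by_cases hTu : T ⊆ Set.Iio u
  · exact h0 J ⟨B, hTB.trans (Set.union_subset_union_right _ (Set.image_mono hTu)), hf, hJ⟩
  · obtain ⟨w, hw, hwu⟩ := Set.not_subset.1 hTu
    obtain ⟨v, hv, hmax⟩ := Set.exists_max_image T id hT ⟨w, hw⟩
    exact h v (hTS hv) ((not_lt.1 hwu).trans (hmax w hw)) J
      ⟨B, hTB.trans (Set.union_subset_union_right _ (Set.image_mono hmax)), hf, hJ⟩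

theorem exists_countable_isAlmostDisjointFamily :
    ∃ A : Set (Set ℕ), A.Countable ∧ IsAlmostDisjointFamily A := by
  let c : ℕ → Set ℕ := fun n => Set.range (Nat.pair n)
  have hinj : ∀ n, Function.Injective (Nat.pair n) := fun n k k' h => (Nat.pair_eq_pair.1 h).2
  have hc : Function.Injective c := fun n n' h => by
    obtain ⟨k, hk⟩ : Nat.pair n 0 ∈ c n' := h ▸ ⟨0, rfl⟩
    exact (Nat.pair_eq_pair.1 hk).1.symm
  refine ⟨Set.range c, Set.countable_range c, Set.infinite_range_of_injective hc, ?_, ?_⟩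
  · rintro _ ⟨n, rfl⟩
    exact Set.infinite_range_of_injective (hinj n)
  · rintro _ ⟨n, rfl⟩ _ ⟨m, rfl⟩ hnm
    convert Set.finite_empty
    refine Set.eq_empty_of_forall_notMem ?_
    rintro x ⟨⟨k, rfl⟩, k', hk'⟩
    exact hnm (congrArg c (Nat.pair_eq_pair.1 hk').1.symm)

theorem isAlmostDisjointFamily_union_range {ι : Type*} [LinearOrder ι] {A : Set (Set ℕ)}
    (hA : IsAlmostDisjointFamily A) {a : ι → Set ℕ}
    (ha : ∀ t, a t ∈ A ∨ (a t).Infinite ∧ ∀ c ∈ A ∪ a '' Set.Iio t, (c ∩ a t).Finite) :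
    IsAlmostDisjointFamily (A ∪ Set.range a) := by
  have hAa : ∀ c ∈ A, ∀ t, c ≠ a t → (c ∩ a t).Finite := fun c hc t hne =>
    (ha t).elim (fun h => hA.2.2 hc h hne) fun h => h.2 c (Or.inl hc)
  have haa : ∀ t u, u < t → a u ≠ a t → (a u ∩ a t).Finite := fun t u hut hne =>
    (ha t).elim (fun h => (Set.inter_comm _ _) ▸ hAa _ h u hne.symm)
      fun h => h.2 _ (Or.inr ⟨u, hut, rfl⟩)
  refine ⟨hA.1.mono Set.subset_union_left, ?_, ?_⟩
  · rintro _ (h | ⟨t, rfl⟩)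
    · exact hA.2.1 _ h
    · exact (ha t).elim (hA.2.1 _) And.left
  · rintro x (hx | ⟨t, rfl⟩) y (hy | ⟨u, rfl⟩) hne
    · exact hA.2.2 hx hy hne
    · exact hAa x hx u hne
    · exact (Set.inter_comm _ _) ▸ hAa y hy t hne.symm
    · rcases lt_trichotomy t u with h | rfl | h
      · exact haa u t h hne
      · exact absurd rfl hne
      · exact (Set.inter_comm _ _) ▸ haa t u h hne.symm

/-! ### The construction -/

theorem mk_sequences_prod : #((ℕ → Set (Finset ℕ)) × Set ℕ) = continuum := by
  simp

theorem proposition3p2 (h : dominatingNumber = Cardinal.continuum) :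
    ∃ A : Set (Set ℕ), A.Infinite ∧ IsMadFamily A ∧ IsMengerFamily (generatedIdeal A) := by
  classical
  have hd : ℵ₀ < dominatingNumber := h ▸ aleph0_lt_continuum
  obtain ⟨A, hAc, hA⟩ := exists_countable_isAlmostDisjointFamily
  let ι : Type := continuum.{0}.ord.ToType
  have hι : ∀ t : ι, #(Set.Iio t) < dominatingNumber := fun t => by
    rw [h]
    exact (mk_Iio_lt t (by rw [mk_ord_toType]; exact (Ordinal.type_toType _).symm)).trans_eq
      (mk_ord_toType _)
  obtain ⟨e⟩ : Nonempty (ι ≃ (ℕ → Set (Finset ℕ)) × Set ℕ) := Cardinal.eq.1 (by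
    rw [mk_sequences_prod, mk_ord_toType])
  let below : ι → (ι → Set ℕ × (ℕ → ℕ)) → Set (Set ℕ) := fun t f =>
    A ∪ (fun u => (f u).1) '' Set.Iio t
  have hbelow : ∀ t f f', (∀ u < t, f u = f' u) → below t f = below t f' := fun t f f' hff' =>
    congrArg (A ∪ ·) (Set.image_congr fun u hu => by rw [hff' u hu])
  let pos : ι → (ι → Set ℕ × (ℕ → ℕ)) → Prop := fun t f =>
    ∀ n, AvoidsFamily ((e t).1 n) (generatedIdeal (below t f))
  -- A value is a new set with a bound for `(e t).1`; a set already in `A` stands for adding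
  -- nothing.
  let P : ι → (ι → Set ℕ × (ℕ → ℕ)) → Set ℕ × (ℕ → ℕ) → Prop := fun t f y =>
    (pos t f → AvoidsFamily (boundedUnion (e t).1 y.2) (generatedIdeal (insert y.1 (below t f)))) ∧
    (pos t f → AvoidsFamily (boundedUnion (e t).1 y.2) (generatedIdeal (below t f))) ∧
    (∀ u < t, pos u f → AvoidsFamily (boundedUnion (e u).1 (f u).2)
      (generatedIdeal (insert y.1 (below t f)))) ∧
    (y.1 ∈ A ∨ y.1.Infinite ∧ ∀ c ∈ below t f, (c ∩ y.1).Finite) ∧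
    ((e t).2.Infinite → (∀ c ∈ below t f, (c ∩ (e t).2).Finite) →
      y.1 ⊆ (e t).2 ∧ y.1.Infinite)
  have hinsert : ∀ t f, insert (f t).1 (below t f) = A ∪ (fun u => (f u).1) '' Set.Iic t := by
    intro t f
    rw [← Set.Iio_insert, Set.image_insert_eq, Set.union_insert]
  have hpreserve : ∀ f S u, (∀ v ∈ S ∪ {u}, P v f (f v)) → pos u f →
      AvoidsFamily (boundedUnion (e u).1 (f u).2)
        (generatedIdeal (A ∪ (fun u => (f u).1) '' S)) := by
    intro f S u hS hu
    refine avoidsFamily_generatedIdeal_of_forall_Iic ((hS u (Or.inr rfl)).2.1 hu) fun v hv huv => ?_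
    rw [← hinsert]
    rcases huv.eq_or_lt with rfl | huv
    · exact (hS u (Or.inr rfl)).1 hu
    · exact (hS v (Or.inl hv)).2.2.1 u huv hu
  obtain ⟨f, hf⟩ : ∃ f, ∀ t, P t f (f t) := by
    refine exists_forall_of_wellFoundedLT P ?_ ?_
    · intro t f f' y hff' hP
      have hpos : ∀ u ≤ t, pos u f' → pos u f := fun u hu hp => by
        simp only [pos]
        rw [hbelow u f f' fun v hv => hff' v (hv.trans_le hu)]
        exact hp
      have hb := hbelow t f f' hff'
      simp only [P] at hP ⊢
      rw [← hb]
      refine ⟨fun hp => hP.1 (hpos t le_rfl hp), fun hp => hP.2.1 (hpos t le_rfl hp),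
        fun u hu hp => ?_, hP.2.2.2⟩
      rw [← hff' u hu]
      exact hP.2.2.1 u hu (hpos u hu.le hp)
    · intro t f hf
      have hcard : #(below t f) < dominatingNumber :=
        (mk_union_le _ _).trans_lt (add_lt_of_lt hd.le (hAc.le_aleph0.trans_lt hd)
          (mk_image_le.trans_lt (hι t)))
      obtain ⟨g, hg⟩ : ∃ g, pos t f →
          AvoidsFamily (boundedUnion (e t).1 g) (generatedIdeal (below t f)) := by
        by_cases hp : pos t f
        · exact (exists_avoidsFamily_boundedUnion hcard hd hp).imp fun g hg _ => hg
        · exact ⟨0, fun h => absurd h hp⟩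
      have hold : ∀ u < t, pos u f →
          AvoidsFamily (boundedUnion (e u).1 (f u).2) (generatedIdeal (below t f)) :=
        fun u hu hp => hpreserve f (Set.Iio t) u (by
          rintro v (hv | rfl)
          · exact hf v hv
          · exact hf v hu) hp
      by_cases hb : (e t).2.Infinite ∧ ∀ c ∈ below t f, (c ∩ (e t).2).Finite
      · let L : Type := {u : ι // u ≤ t ∧ pos u f}
        have hL : #L < dominatingNumber := by
          refine (mk_le_mk_of_subset (s := {u | u ≤ t ∧ pos u f}) (t := Set.Iic t)
            fun u hu => hu.1).trans_lt ?_
          rw [← Set.Iio_insert]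
          exact mk_insert_le.trans_lt (add_lt_of_lt hd.le (hι t) (one_lt_aleph0.trans hd))
        -- The promise just made with `g` is protected together with the older ones.
        obtain ⟨a, hab, ha, haZ⟩ := exists_subset_avoidsFamily_insert hcard hd hL
          (Z := fun u => boundedUnion (e u.1).1 (if u.1 = t then g else (f u.1).2)) (by
            rintro ⟨u, hut, hp⟩
            rcases hut.eq_or_lt with rfl | hut
            · simpa using hg hp
            · simpa [hut.ne] using hold u hut hp) hb.1
        refine ⟨(a, g), fun hp => ?_, hg, fun u hu hp => ?_, Or.inr ⟨ha, fun c hc => ?_⟩,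
          fun _ _ => ⟨hab, ha⟩⟩
        · simpa using haZ ⟨t, le_rfl, hp⟩
        · simpa [hu.ne] using haZ ⟨u, hu.le, hp⟩
        · exact (hb.2 c hc).subset (Set.inter_subset_inter_right _ hab)
      · obtain ⟨a, ha⟩ := hA.1.nonempty
        have hins : insert a (below t f) = below t f := Set.insert_eq_of_mem (Or.inl ha)
        refine ⟨(a, g), ?_, hg, ?_, Or.inl ha, fun h1 h2 => absurd ⟨h1, h2⟩ hb⟩
        · rwa [hins]
        · rwa [hins]
  have hbelow_subset : ∀ t, below t f ⊆ A ∪ Set.range (fun u => (f u).1) := fun t =>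
    Set.union_subset_union_right _ (Set.image_subset_range _ _)
  have hAD : IsAlmostDisjointFamily (A ∪ Set.range fun u => (f u).1) :=
    isAlmostDisjointFamily_union_range hA fun t => (hf t).2.2.2.1
  refine ⟨A ∪ Set.range fun u => (f u).1, hAD.1, ⟨hAD, fun A' hA' hle b hb => ?_⟩, ?_⟩
  · by_contra hbA
    have hbc : ∀ c ∈ A ∪ Set.range (fun u => (f u).1), (c ∩ b).Finite := fun c hc =>
      hA'.2.2 (hle hc) hb fun hcb => hbA (hcb ▸ hc)
    -- At the stage handling `b`, an infinite subset of `b` entered the family, against almost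
    -- disjointness.
    obtain ⟨t, ht⟩ := e.surjective (fun _ => ∅, b)
    have htb : (e t).2 = b := by rw [ht]
    obtain ⟨hsub, hinf⟩ := (hf t).2.2.2.2 (htb ▸ hA'.2.1 b hb)
      fun c hc => htb ▸ hbc c (hbelow_subset t hc)
    refine hinf ((hbc _ (Or.inr ⟨t, rfl⟩)).subset fun x hx => ⟨hx, htb ▸ hsub hx⟩)
  · refine isMengerFamily_of_avoidsFamily (fun J hJ J' => generatedIdeal_subset hJ) fun X hX => ?_
    obtain ⟨t, ht⟩ := e.surjective (X, ∅)
    have htX : (e t).1 = X := by rw [ht]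
    refine ⟨(f t).2, ?_⟩
    rw [← htX, ← Set.image_univ]
    refine hpreserve f Set.univ t (fun v _ => hf v) fun n => ?_
    rw [htX]
    -- Avoiding the final ideal implies avoiding the smaller one at stage `t`, so the promise was
    -- made there.
    exact (hX n).mono (generatedIdeal_mono (hbelow_subset t))
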